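/- Let $n,m\ge 0$ and let $\dot x=f(t,x,u)$, $x\in\mathbb R^n$, $u\in\mathbb R^m$, be a smooth ($C^\infty$) control system on an open set $M\subseteq\mathbb R\times\mathbb R^n\times\mathbb R^m$ which is regular, i.e. $u\mapsto f(t,x,u)$ has maximal rank at every point of $M$. Then the system is explicitly integrable if and only if it is dynamic feedback linearizable. Both notions are local and generic, in the following sense. A trajectory is a smooth solution $(x(t),u(t))$, for $t$ in an open set of times, with $(t,x(t),u(t))\in M$. Its jet at time $t$ is $(t,x(t),u(t),\dot u(t),\ddot u(t),\dots)$, and the jets $(t,x,u_0,u_1,\dots)$ with $(t,x,u_0)\in M$ form a space $J^\infty(M)$ with the product topology. Saying that a trajectory is "in $V$" means that all its jets lie in $V$. *Explicitly integrable*: for every nonempty open $V_0\subseteq J^\infty(M)$ there are integers $r_1,\dots,r_m>0$, a nonempty open set $D$ in the space of jets $(t,z^a,(z^a)',\dots,(z^a)^{(r_a)})_{1\le a\le m}$, and smooth maps $A:D\to\mathbb R^n$, $B:D\to\mathbb R^m$ (a Monge parametrization) such that 1. for arbitrary smooth functions $z^1(t),\dots,z^m(t)$ with jets in $D$, the formulas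 $$x(t)=A\big(t,z^a(t),(z^a)'(t),\dots,(z^a)^{(r_a)}(t)\big),\qquad u(t)=B\big(t,z^a(t),(z^a)'(t),\dots,(z^a)^{(r_a)}(t)\big)$$ define a trajectory; and 2. for every nonempty open $D'\subseteq D$ there is a nonempty open $V\subseteq V_0$ such that every trajectory in $V$ is, near each time, given by these formulas for some smooth $z^1,\dots,z^m$ with jets in $D'$. *Dynamic feedback linearizable*: for every nonempty open $V_0\subseteq J^\infty(M)$ there are $k\ge 0$, $m'\ge m$, a nonempty open set $\hat M\subseteq\mathbb R\times\mathbb R^{n}\times\mathbb R^{k}\times\mathbb R^{m'}$ and smooth maps $g:\hat M\to\mathbb R^k$, $\beta:\hat M\to\mathbb R^m$ with $(t,x,\beta(t,x,y,w))\in M$ on $\hat M$, such that the dynamic feedback $$\dot x=f(t,x,\beta(t,x,y,w)),\qquad \dot y=g(t,x,y,w),\qquad u=\beta(t,x,y,w)$$ has the following properties. 1. It is regular: $m'=m$, and it satisfies the solution correspondence condition: for every nonempty open $N\subseteq\hat M$ there is a nonempty open $V\subseteq V_0$ such that for every trajectory $(x(t),u(t))$ in $V$ there exist, near each time, smooth functions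 $(y(t),w(t))$ which together with $(x(t),u(t))$ satisfy the three equations above, with $(t,x(t),y(t),w(t))\in N$. 2. The augmented system, with state $(x,y)$ and control $w$, is static feedback linearizable: near every point of $\hat M$ there is a transformation $(x,y)=\theta(t,z)$, $w=\psi(t,z,v)$ such that $(t,z,v)\mapsto(t,\theta(t,z),\psi(t,z,v))$ is a local diffeomorphism which transforms the augmented system to a Brunovský normal form $$\dot z^a_\ell=z^a_{\ell+1}\ \ (0\le \ell\le r_a-2),\qquad \dot z^a_{r_a-1}=v^a,\qquad 1\le a\le m,\quad r_a\ge 1 .$$ -/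

import Mathlib

open scoped ContDiff Manifold

/-- A smooth control system `ẋ = f(t, x, u)`, with state space `X` and control space `U`, on an
open set of points `(t, x, u)`. -/
structure ControlSystem (X U : Type) [NormedAddCommGroup X] [NormedSpace ℝ X]
    [NormedAddCommGroup U] [NormedSpace ℝ U] where
  domain : Set (ℝ × X × U)
  isOpen_domain : IsOpen domain
  f : ℝ × X × U → X
  smooth_f : ContDiffOn ℝ ∞ f domain

namespace ControlSystem

section General

variable {X U Z W : Type}
  [NormedAddCommGroup X] [NormedSpace ℝ X] [NormedAddCommGroup U] [NormedSpace ℝ U]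
  [NormedAddCommGroup Z] [NormedSpace ℝ Z] [NormedAddCommGroup W] [NormedSpace ℝ W]

/-- `(x(t), u(t))`, `t ∈ I`, is a smooth trajectory (solution) of the system. Here `I` is an open
set of times; every use below is local in time. -/
def IsTrajectory (S : ControlSystem X U) (I : Set ℝ) (x : ℝ → X) (u : ℝ → U) : Prop :=
  IsOpen I ∧ ContDiffOn ℝ ∞ x I ∧ ContDiffOn ℝ ∞ u I ∧
    ∀ t ∈ I, (t, x t, u t) ∈ S.domain ∧ HasDerivAt x (S.f (t, x t, u t)) t

/-- The map `(t, z, v) ↦ (t, θ(t, z), ψ(t, z, v))`. -/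
def feedbackMap (θ : ℝ × Z → X) (ψ : ℝ × Z × W → U) : ℝ × Z × W → ℝ × X × U :=
  fun q => (q.1, θ (q.1, q.2.1), ψ q)

/-- On the open set `D`, the substitution `x = θ(t, z)`, `u = ψ(t, z, v)` is a local diffeomorphism
which transforms the system `S` into the system `S'`: if `ż = S'.f(t, z, v)`, then the total time
derivative of `θ(t, z)` is `S.f(t, θ(t, z), ψ(t, z, v))`. -/
def IsStaticFeedbackTransformation (S : ControlSystem X U) (S' : ControlSystem Z W)
    (D : Set (ℝ × Z × W)) (θ : ℝ × Z → X) (ψ : ℝ × Z × W → U) : Prop :=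
  IsOpen D ∧ D ⊆ S'.domain ∧ Set.MapsTo (feedbackMap θ ψ) D S.domain ∧
    IsLocalDiffeomorphOn 𝓘(ℝ, ℝ × Z × W) 𝓘(ℝ, ℝ × X × U) ∞ (feedbackMap θ ψ) D ∧
    ∀ q ∈ D, fderiv ℝ θ (q.1, q.2.1) (1, S'.f q) = S.f (feedbackMap θ ψ q)

end General

/-- The system in Brunovsky normal form with `m` chains of integrators of lengths
`r 0, …, r (m - 1)`: `ż^a_l = z^a_{l+1}` for `l + 1 < r a`, and `ż^a_{r a - 1} = v^a`. -/
noncomputable def brunovsky {m : ℕ} (r : Fin m → ℕ) :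
    ControlSystem ((a : Fin m) → Fin (r a) → ℝ) (Fin m → ℝ) where
  domain := Set.univ
  isOpen_domain := isOpen_univ
  f := fun q a l => if h : l.1 + 1 < r a then q.2.1 a ⟨l.1 + 1, h⟩ else q.2.2 a
  smooth_f := by
    refine ContDiff.contDiffOn ?_
    refine contDiff_pi.2 fun a => contDiff_pi.2 fun l => ?_
    by_cases h : l.1 + 1 < r a
    · simp only [h, dif_pos]
      have hz : ContDiff ℝ ∞
          (fun q : ℝ × ((a : Fin m) → Fin (r a) → ℝ) × (Fin m → ℝ) => q.2.1) := by fun_prop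
      exact contDiff_pi.1 (contDiff_pi.1 hz a) ⟨l.1 + 1, h⟩
    · simp only [h, dif_neg, not_false_eq_true]
      fun_prop

/-- Static feedback linearizability (a local notion): near every point of its domain, the system
is transformed into a system in Brunovsky normal form, with as many chains as there are controls,
each of length at least one. -/
def IsStaticFeedbackLinearizable {X : Type} [NormedAddCommGroup X] [NormedSpace ℝ X] {m : ℕ}
    (S : ControlSystem X (Fin m → ℝ)) : Prop :=
  ∀ p ∈ S.domain, ∃ r : Fin m → ℕ, (∀ a, 1 ≤ r a) ∧
    ∃ (D : Set (ℝ × ((a : Fin m) → Fin (r a) → ℝ) × (Fin m → ℝ)))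
      (θ : ℝ × ((a : Fin m) → Fin (r a) → ℝ) → X)
      (ψ : ℝ × ((a : Fin m) → Fin (r a) → ℝ) × (Fin m → ℝ) → (Fin m → ℝ)),
      S.IsStaticFeedbackTransformation (brunovsky r) D θ ψ ∧ p ∈ feedbackMap θ ψ '' D

variable {n m : ℕ}

/-- Regularity: the map `u ↦ f(t, x, u)` has maximal rank at every point. -/
def IsRegular (S : ControlSystem (Fin n → ℝ) (Fin m → ℝ)) : Prop :=
  ∀ t x u, (t, x, u) ∈ S.domain →
    Module.finrank ℝ (fderiv ℝ (fun v => S.f (t, x, v)) u).range = min n m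

/-- Infinite jets `(t, x, u, u̇, ü, …)` of trajectories of control systems. The topology is the
product topology, so that a basic open set restricts only finitely many derivatives of `u`. (The
derivatives of `x` are determined by the system.) -/
abbrev TrajectoryJet (n m : ℕ) : Type := ℝ × (Fin n → ℝ) × (ℕ → Fin m → ℝ)

/-- The jet of `(x(t), u(t))` at the time `t`. -/
noncomputable def trajectoryJet (x : ℝ → Fin n → ℝ) (u : ℝ → Fin m → ℝ) (t : ℝ) :
    TrajectoryJet n m :=
  (t, x t, fun j => iteratedDeriv j u t)

/-- The set of jets of the trajectories of the system `S`. -/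
def jets (S : ControlSystem (Fin n → ℝ) (Fin m → ℝ)) : Set (TrajectoryJet n m) :=
  {ζ | (ζ.1, ζ.2.1, ζ.2.2 0) ∈ S.domain}

/-- The coordinates `(t, z^a, (z^a)', …, (z^a)^{(r a)})` on the jet space of `m` functions of `t`. -/
abbrev FunctionJet {m : ℕ} (r : Fin m → ℕ) : Type := ℝ × ((a : Fin m) → Fin (r a + 1) → ℝ)

/-- The jet of `z = (z^1, …, z^m)` at the time `t`, of order `r a` in the function `z^a`. -/
noncomputable def functionJet (r : Fin m → ℕ) (z : ℝ → Fin m → ℝ) (t : ℝ) : FunctionJet r :=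
  (t, fun a l => iteratedDeriv l.1 (fun s => z s a) t)

/-- A Monge parametrization on an open set `D` of jets of `m` functions: smooth maps `A`, `B`
such that for arbitrary smooth functions `z` whose jets lie in `D`, the formulas
`x = A(t, z, z', …)`, `u = B(t, z, z', …)` give a trajectory of the system. -/
structure IsMongeParametrization (S : ControlSystem (Fin n → ℝ) (Fin m → ℝ)) (r : Fin m → ℕ)
    (D : Set (FunctionJet r)) (A : FunctionJet r → Fin n → ℝ) (B : FunctionJet r → Fin m → ℝ) :
    Prop where
  isOpen : IsOpen D
  nonempty : D.Nonempty
  order_pos : ∀ a, 0 < r a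
  smooth_A : ContDiffOn ℝ ∞ A D
  smooth_B : ContDiffOn ℝ ∞ B D
  isTrajectory : ∀ (I : Set ℝ) (z : ℝ → Fin m → ℝ), IsOpen I → ContDiffOn ℝ ∞ z I →
    (∀ t ∈ I, functionJet r z t ∈ D) →
    S.IsTrajectory I (fun t => A (functionJet r z t)) (fun t => B (functionJet r z t))

/-- Every trajectory with jets in `V` is locally of the form `x = A(t, z, z', …)`,
`u = B(t, z, z', …)`, for smooth functions `z` with jets in `D`. -/
def Parametrizes (S : ControlSystem (Fin n → ℝ) (Fin m → ℝ)) (r : Fin m → ℕ)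
    (A : FunctionJet r → Fin n → ℝ) (B : FunctionJet r → Fin m → ℝ)
    (D : Set (FunctionJet r)) (V : Set (TrajectoryJet n m)) : Prop :=
  ∀ (I : Set ℝ) (x : ℝ → Fin n → ℝ) (u : ℝ → Fin m → ℝ), S.IsTrajectory I x u →
    (∀ t ∈ I, trajectoryJet x u t ∈ V) → ∀ t₀ ∈ I,
      ∃ J : Set ℝ, IsOpen J ∧ t₀ ∈ J ∧ J ⊆ I ∧
        ∃ z : ℝ → Fin m → ℝ, ContDiffOn ℝ ∞ z J ∧ ∀ t ∈ J,
          functionJet r z t ∈ D ∧ x t = A (functionJet r z t) ∧ u t = B (functionJet r z t)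

/-- Explicit integrability (a local and generic notion). The generic jets of trajectories form an
open dense set, the union of sets `V`: in every nonempty open set `V₀` of jets of trajectories of
the system there is such a `V`, also nonempty and open, for which some Monge parametrization gives,
locally, all trajectories with jets in `V`. Being local, this is to survive any restriction of the
parametrization to a smaller nonempty open set `D'`, with a `V` depending on `D'`. -/
def IsExplicitlyIntegrable (S : ControlSystem (Fin n → ℝ) (Fin m → ℝ)) : Prop :=
  ∀ V₀ : Set (TrajectoryJet n m), IsOpen V₀ → V₀.Nonempty → V₀ ⊆ S.jets →
    ∃ (r : Fin m → ℕ) (D : Set (FunctionJet r)) (A : FunctionJet r → Fin n → ℝ)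
      (B : FunctionJet r → Fin m → ℝ), S.IsMongeParametrization r D A B ∧
      ∀ D' ⊆ D, IsOpen D' → D'.Nonempty →
        ∃ V ⊆ V₀, IsOpen V ∧ V.Nonempty ∧ S.Parametrizes r A B D' V

/-- A dynamic feedback `ẏ = g(t, x, y, w)`, `u = β(t, x, y, w)`, with `y ∈ ℝ^k` and `w ∈ ℝ^m'`,
`m' ≥ m`, on an open set of points `(t, (x, y), w)`. -/
structure DynamicFeedback (S : ControlSystem (Fin n → ℝ) (Fin m → ℝ)) (k m' : ℕ) where
  le : m ≤ m'
  domain : Set (ℝ × ((Fin n → ℝ) × (Fin k → ℝ)) × (Fin m' → ℝ))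
  isOpen_domain : IsOpen domain
  g : ℝ × ((Fin n → ℝ) × (Fin k → ℝ)) × (Fin m' → ℝ) → Fin k → ℝ
  β : ℝ × ((Fin n → ℝ) × (Fin k → ℝ)) × (Fin m' → ℝ) → Fin m → ℝ
  smooth_g : ContDiffOn ℝ ∞ g domain
  smooth_β : ContDiffOn ℝ ∞ β domain
  mem_domain : ∀ p ∈ domain, (p.1, p.2.1.1, β p) ∈ S.domain

namespace DynamicFeedback

variable {S : ControlSystem (Fin n → ℝ) (Fin m → ℝ)} {k m' : ℕ}

/-- The augmented system `ẋ = f(t, x, β(t, x, y, w))`, `ẏ = g(t, x, y, w)`, with state `(x, y)` and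
control `w`. -/
def augmented (F : DynamicFeedback S k m') :
    ControlSystem ((Fin n → ℝ) × (Fin k → ℝ)) (Fin m' → ℝ) where
  domain := F.domain
  isOpen_domain := F.isOpen_domain
  f := fun p => (S.f (p.1, p.2.1.1, F.β p), F.g p)
  smooth_f := by
    refine ContDiffOn.prodMk ?_ F.smooth_g
    refine S.smooth_f.comp (t := S.domain) ?_ F.mem_domain
    have h := F.smooth_β
    fun_prop

/-- Every trajectory `(x(t), u(t))` of the original system with jets in `V` extends locally, by
smooth functions `(y(t), w(t))`, to a solution of the augmented system that lies in `N` and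
satisfies `u = β(t, x, y, w)`. -/
def Lifts (F : DynamicFeedback S k m')
    (N : Set (ℝ × ((Fin n → ℝ) × (Fin k → ℝ)) × (Fin m' → ℝ)))
    (V : Set (TrajectoryJet n m)) : Prop :=
  ∀ (I : Set ℝ) (x : ℝ → Fin n → ℝ) (u : ℝ → Fin m → ℝ), S.IsTrajectory I x u →
    (∀ t ∈ I, trajectoryJet x u t ∈ V) → ∀ t₀ ∈ I,
      ∃ J : Set ℝ, IsOpen J ∧ t₀ ∈ J ∧ J ⊆ I ∧
        ∃ (y : ℝ → Fin k → ℝ) (w : ℝ → Fin m' → ℝ),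
          F.augmented.IsTrajectory J (fun t => (x t, y t)) w ∧ ∀ t ∈ J,
            (t, (x t, y t), w t) ∈ N ∧ u t = F.β (t, (x t, y t), w t)

/-- The solution correspondence condition, as a local condition within the set `V₀` of jets of
trajectories: all trajectories with jets in some nonempty open set `V ⊆ V₀` extend to solutions of
the augmented system. Being local, this is to survive any restriction of the augmented system to a
smaller nonempty open set `N`, with a `V` depending on `N`. -/
def SolutionCorrespondence (F : DynamicFeedback S k m') (V₀ : Set (TrajectoryJet n m)) : Prop :=
  ∀ N ⊆ F.domain, IsOpen N → N.Nonempty →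
    ∃ V ⊆ V₀, IsOpen V ∧ V.Nonempty ∧ F.Lifts N V

/-- A dynamic feedback is regular if `m' = m` and it satisfies the solution correspondence
condition. -/
def IsRegular (F : DynamicFeedback S k m') (V₀ : Set (TrajectoryJet n m)) : Prop :=
  m' = m ∧ F.SolutionCorrespondence V₀

end DynamicFeedback

/-- Dynamic feedback linearizability (a local and generic notion): in every nonempty open set `V₀`
of jets of trajectories of the system, some regular dynamic feedback, with nonempty domain, has a
static feedback linearizable augmented system. -/
def IsDynamicFeedbackLinearizable (S : ControlSystem (Fin n → ℝ) (Fin m → ℝ)) : Prop :=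
  ∀ V₀ : Set (TrajectoryJet n m), IsOpen V₀ → V₀.Nonempty → V₀ ⊆ S.jets →
    ∃ (k m' : ℕ) (F : DynamicFeedback S k m'),
      F.domain.Nonempty ∧ F.IsRegular V₀ ∧ F.augmented.IsStaticFeedbackLinearizable

end ControlSystem

namespace ControlSystem

/-! ### Calculus: higher derivatives, prescribed Taylor coefficients, inverse functions -/

section Calculus

variable {E F : Type*} [NormedAddCommGroup E] [NormedSpace ℝ E]
  [NormedAddCommGroup F] [NormedSpace ℝ F]

/-! A jet of order `r a` in each function `z^a`, all `r a` positive, is a state together with a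
control of the Brunovsky system with chain lengths `r a` (`jetEquiv`), and solutions of that system
are exactly jets of functions. A dynamic feedback whose augmented system is locally equivalent to
Brunovsky form therefore expresses `x` and `u` through such jets. Solution correspondence, followed
by the inverse of the local diffeomorphism (`exists_lift`), shows that every trajectory in some open
set arises in this way.

Conversely, let `x = A`, `u = B` be a Monge parametrization. Differentiating `x = A` along an
arbitrary `z` brings in derivatives of one order more, which do not enter `f(t, A, B)`; hence `A` is
locally independent of the top-order derivatives (`fderiv_state_top`), that is, a function of `t`
and the Brunovsky state. Near a point where `(t, A)` is a submersion, finitely many linear functions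
`y = L z` of that state complete `A` to coordinates (`exists_chart`). The Brunovsky system written
in the state coordinates `(x, y)`, with its own control as `w`, is then the augmented system of a
dynamic feedback with `β = B`.

A point of submersion exists: otherwise a constant rank argument yields an open set `D'` of jets
whose image under `(t, A)` has empty interior (`exists_interior_image_eq_empty`), whereas the
trajectories with jets in an open `V` sweep out an open set of points `(t, x)`. This uses the
freedom to shrink the parametrization to `D'`. -/

theorem contDiffOn_iteratedDeriv {I : Set ℝ} (hI : IsOpen I) {h : ℝ → E}
    (hh : ContDiffOn ℝ ∞ h I) (l : ℕ) : ContDiffOn ℝ ∞ (iteratedDeriv l h) I := by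
  induction l with
  | zero => simpa using hh
  | succ l ih =>
    rw [iteratedDeriv_succ]
    exact ((contDiffOn_infty_iff_deriv_of_isOpen hI).1 ih).2

theorem hasDerivAt_iteratedDeriv {I : Set ℝ} (hI : IsOpen I) {h : ℝ → E}
    (hh : ContDiffOn ℝ ∞ h I) (l : ℕ) {t : ℝ} (ht : t ∈ I) :
    HasDerivAt (iteratedDeriv l h) (iteratedDeriv (l + 1) h t) t := by
  rw [iteratedDeriv_succ]
  exact (((contDiffOn_infty_iff_deriv_of_isOpen hI).1
    (contDiffOn_iteratedDeriv hI hh l)).1.differentiableAt (hI.mem_nhds ht)).hasDerivAt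

/-- There is a polynomial function with finitely many prescribed derivatives at a point, all other
derivatives being zero. -/
theorem exists_contDiff_iteratedDeriv_eq (t : ℝ) (N : ℕ) (c : ℕ → E) :
    ∃ h : ℝ → E, ContDiff ℝ ∞ h ∧ ∀ j, iteratedDeriv j h t = if j < N then c j else 0 := by
  let T : ℕ → (ℕ → E) → ℝ → E := fun N c s =>
    ∑ i ∈ Finset.range N, ((s - t) ^ i / (i.factorial : ℝ)) • c i
  have hT : ∀ N c, ContDiff ℝ ∞ (T N c) := by
    intro N c
    refine ContDiff.sum fun i _ => ContDiff.smul ?_ contDiff_const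
    exact ((contDiff_id.sub contDiff_const).pow i).div_const _
  -- Differentiating a Taylor polynomial shifts its coefficients, so the claim follows by induction
  -- on the order `j`.
  have hd : ∀ N c, deriv (T (N + 1) c) = T N (fun i => c (i + 1)) := by
    intro N c
    ext s
    have h1 : ∀ i : ℕ, HasDerivAt (fun s : ℝ => ((s - t) ^ (i + 1) / ((i + 1).factorial : ℝ)) •
        c (i + 1)) (((s - t) ^ i / (i.factorial : ℝ)) • c (i + 1)) s := by
      intro i
      refine HasDerivAt.smul_const ?_ _
      have := (((hasDerivAt_id s).sub_const t).pow (i + 1)).div_const ((i + 1).factorial : ℝ)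
      convert! this using 1
      have h0 : (i.factorial : ℝ) ≠ 0 := by positivity
      have h2 : (i : ℝ) + 1 ≠ 0 := by positivity
      rw [Nat.factorial_succ]
      push_cast
      simp only [id, mul_one]
      field_simp
    have h2 : HasDerivAt (T (N + 1) c) (T N (fun i => c (i + 1)) s) s := by
      have h3 : T (N + 1) c = fun s => (∑ i ∈ Finset.range N,
          ((s - t) ^ (i + 1) / ((i + 1).factorial : ℝ)) • c (i + 1)) + c 0 := by
        funext s
        simp [T, Finset.sum_range_succ']
      rw [h3]
      exact (HasDerivAt.fun_sum fun i _ => h1 i).add_const _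
    exact h2.deriv
  refine ⟨T N c, hT N c, fun j => ?_⟩
  induction j generalizing N c with
  | zero => cases N with
    | zero => simp [T]
    | succ N => simp [T, Finset.sum_range_succ']
  | succ j ih =>
    rw [iteratedDeriv_succ']
    cases N with
    | zero =>
      have h0 : deriv (T 0 c) = T 0 c := by
        have : T 0 c = fun _ => (0 : E) := by funext s; simp [T]
        rw [this]; simp
      rw [h0, ih]; simp
    | succ N => rw [hd, ih]; simp

/-- A function is constant along a segment if its derivative in the direction of the segment
vanishes. -/
theorem eq_of_fderiv_sub_eq_zero {s : Set E} (hs : Convex ℝ s) {f : E → F}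
    (hf : ∀ z ∈ s, DifferentiableAt ℝ f z) {x y : E} (hx : x ∈ s) (hy : y ∈ s)
    (h : ∀ z ∈ s, fderiv ℝ f z (y - x) = 0) : f x = f y := by
  have hl : ∀ τ ∈ Set.Icc (0 : ℝ) 1, x + τ • (y - x) ∈ s := fun τ hτ =>
    hs.add_smul_sub_mem hx hy hτ
  have hd : ∀ τ ∈ Set.Icc (0 : ℝ) 1, HasDerivAt (fun τ : ℝ => f (x + τ • (y - x))) 0 τ := by
    intro τ hτ
    have h1 : HasDerivAt (fun τ : ℝ => x + τ • (y - x)) (y - x) τ := by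
      simpa using ((hasDerivAt_id τ).smul_const (y - x)).const_add x
    have := (hf _ (hl τ hτ)).hasFDerivAt.comp_hasDerivAt τ h1
    rwa [h _ (hl τ hτ)] at this
  have := constant_of_has_deriv_right_zero (f := fun τ : ℝ => f (x + τ • (y - x)))
    (fun τ hτ => (hd τ hτ).continuousAt.continuousWithinAt)
    (fun τ hτ => (hd τ (Set.Ico_subset_Icc_self hτ)).hasDerivWithinAt) 1 (by simp)
  simpa using this.symm

/-- The inverse function theorem: near a point at which its derivative is invertible, a smooth map
is an open partial homeomorphism with smooth inverse. -/
theorem exists_openPartialHomeomorph_of_fderiv [FiniteDimensional ℝ E] {U : Set E}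
    (hU : IsOpen U) {f : E → F} (hf : ContDiffOn ℝ ∞ f U) {a : E} (ha : a ∈ U) (f' : E ≃L[ℝ] F)
    (hf' : fderiv ℝ f a = f') :
    ∃ e : OpenPartialHomeomorph E F, (e : E → F) = f ∧ a ∈ e.source ∧ e.source ⊆ U ∧
      (∀ b ∈ e.source, ∃ f₁ : E ≃L[ℝ] F, fderiv ℝ f b = f₁) ∧ ContDiffOn ℝ ∞ e.symm e.target := by
  have : CompleteSpace E := FiniteDimensional.complete ℝ E
  have hfa : ∀ b ∈ U, ContDiffAt ℝ ∞ f b := fun b hb => hf.contDiffAt (hU.mem_nhds hb)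
  have hda : HasFDerivAt f (f' : E →L[ℝ] F) a := by
    rw [← hf']
    exact ((hfa a ha).differentiableAt (by simp)).hasFDerivAt
  let e₀ := (hfa a ha).toOpenPartialHomeomorph f hda (by simp)
  let G : Set E := U ∩ fderiv ℝ f ⁻¹' Set.range ((↑) : (E ≃L[ℝ] F) → E →L[ℝ] F)
  have hG : IsOpen G := (hf.continuousOn_fderiv_of_isOpen hU (by simp)).isOpen_inter_preimage hU
    ContinuousLinearEquiv.isOpen
  refine ⟨e₀.restrOpen G hG, rfl,
    ⟨(hfa a ha).mem_toOpenPartialHomeomorph_source hda (by simp), ha, ⟨f', hf'.symm⟩⟩,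
    fun b hb => hb.2.1, fun b hb => hb.2.2.imp fun _ h => h.symm, fun b hb => ?_⟩
  have hb' := (e₀.restrOpen G hG).map_target hb
  obtain ⟨f₁, hf₁⟩ := hb'.2.2
  refine (OpenPartialHomeomorph.contDiffAt_symm (f₀' := f₁) _ hb ?_
    (hfa _ hb'.2.1)).contDiffWithinAt
  rw [hf₁]
  exact ((hfa _ hb'.2.1).differentiableAt (by simp)).hasFDerivAt

end Calculus

/-! ### Jets of functions as states and controls of the Brunovsky system -/

section Jets

variable {m : ℕ}

/-- A jet of functions is given by the time, the derivatives below the top order, which form a state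
of the system in Brunovsky normal form, and those of top order, which form a control. -/
noncomputable def jetEquiv (r : Fin m → ℕ) :
    (ℝ × ((a : Fin m) → Fin (r a) → ℝ) × (Fin m → ℝ)) ≃L[ℝ] FunctionJet r :=
  LinearEquiv.toContinuousLinearEquiv
    { toFun := fun q => (q.1, fun a => Fin.snoc (α := fun _ => ℝ) (q.2.1 a) (q.2.2 a))
      invFun := fun j => (j.1, fun a l => j.2 a l.castSucc, fun a => j.2 a (Fin.last _))
      map_add' := by
        intro q q'
        refine Prod.ext rfl (funext fun a => funext fun l => ?_)
        refine Fin.lastCases ?_ (fun l => ?_) l <;> simp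
      map_smul' := by
        intro c q
        refine Prod.ext rfl (funext fun a => funext fun l => ?_)
        refine Fin.lastCases ?_ (fun l => ?_) l <;> simp
      left_inv := by
        intro q
        simp
      right_inv := by
        intro j
        refine Prod.ext rfl (funext fun a => funext fun l => ?_)
        refine Fin.lastCases ?_ (fun l => ?_) l <;> simp }

theorem jetEquiv_symm_apply (r : Fin m → ℕ) (j : FunctionJet r) :
    (jetEquiv r).symm j = (j.1, fun a l => j.2 a l.castSucc, fun a => j.2 a (Fin.last _)) := rfl

variable {r : Fin m → ℕ} {z : ℝ → Fin m → ℝ} {I : Set ℝ}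

theorem contDiffOn_functionJet (hI : IsOpen I) (hz : ContDiffOn ℝ ∞ z I) :
    ContDiffOn ℝ ∞ (functionJet r z) I := by
  refine contDiffOn_id.prodMk (contDiffOn_pi.2 fun a => contDiffOn_pi.2 fun l => ?_)
  exact contDiffOn_iteratedDeriv hI (contDiffOn_pi.1 hz a) l

theorem contDiffOn_jetEquiv_symm_functionJet (hI : IsOpen I) (hz : ContDiffOn ℝ ∞ z I) :
    ContDiffOn ℝ ∞ (fun t => (jetEquiv r).symm (functionJet r z t)) I :=
  (jetEquiv r).symm.contDiff.comp_contDiffOn (contDiffOn_functionJet hI hz)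

/-- The state part of a jet moves by the Brunovsky equations; only the control part involves
derivatives of order `r a + 1`. -/
theorem hasDerivAt_jetEquiv_symm_functionJet (hI : IsOpen I) (hz : ContDiffOn ℝ ∞ z I) {t : ℝ}
    (ht : t ∈ I) : HasDerivAt (fun s => (jetEquiv r).symm (functionJet r z s))
      (1, (brunovsky r).f ((jetEquiv r).symm (functionJet r z t)),
        fun a => iteratedDeriv (r a + 1) (fun s => z s a) t) t := by
  refine (hasDerivAt_id t).prodMk (HasDerivAt.prodMk ?_ ?_)
  · refine hasDerivAt_pi.2 fun a => hasDerivAt_pi.2 fun l => ?_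
    have h := hasDerivAt_iteratedDeriv hI (contDiffOn_pi.1 hz a) l.1 ht
    convert! h using 1
    simp only [brunovsky, jetEquiv_symm_apply, functionJet]
    split_ifs with hl
    · rfl
    · have : l.1 + 1 = r a := by omega
      rw [Fin.val_last, this]
  · exact hasDerivAt_pi.2 fun a => hasDerivAt_iteratedDeriv hI (contDiffOn_pi.1 hz a) (r a) ht

/-- There are functions with prescribed jet at a point, and prescribed derivatives of the next
order. -/
theorem exists_functionJet_eq (q : ℝ × ((a : Fin m) → Fin (r a) → ℝ) × (Fin m → ℝ))
    (w : Fin m → ℝ) : ∃ z : ℝ → Fin m → ℝ, ContDiff ℝ ∞ z ∧ functionJet r z q.1 = jetEquiv r q ∧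
      ∀ a, iteratedDeriv (r a + 1) (fun s => z s a) q.1 = w a := by
  -- Orders `0, …, r a` come from the jet and order `r a + 1` from `w`: hence `r a + 2` prescribed
  -- values.
  have h : ∀ a : Fin m, ∃ h : ℝ → ℝ, ContDiff ℝ ∞ h ∧
      ∀ j, iteratedDeriv j h q.1 = if j < r a + 2 then
        (if hj : j < r a + 1 then (jetEquiv r q).2 a ⟨j, hj⟩ else w a) else 0 := fun a =>
    exists_contDiff_iteratedDeriv_eq q.1 (r a + 2)
      (fun j => if hj : j < r a + 1 then (jetEquiv r q).2 a ⟨j, hj⟩ else w a)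
  choose z hz hz' using h
  refine ⟨fun s a => z a s, contDiff_pi.2 hz, ?_, fun a => ?_⟩
  · refine Prod.ext rfl (funext fun a => funext fun l => ?_)
    have := l.2
    simp only [functionJet, hz']
    rw [if_pos (by omega), dif_pos this]
  · rw [hz', if_pos (by omega), dif_neg (by omega)]

end Jets

/-! ### Linear algebra, and maps that are nowhere submersive -/

section Rank

/-- Every subspace of a finite-dimensional space is the range of a continuous linear projection. -/
theorem exists_projection {F : Type*} [NormedAddCommGroup F] [NormedSpace ℝ F]
    [FiniteDimensional ℝ F] (R : Submodule ℝ F) : ∃ P : F →L[ℝ] R, ∀ v : R, P v = v := by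
  obtain ⟨g, hg⟩ := R.subtype.exists_leftInverse_of_injective R.ker_subtype
  exact ⟨LinearMap.toContinuousLinearMap g, fun v => LinearMap.congr_fun hg v⟩

variable {E F : Type*} [NormedAddCommGroup E] [NormedSpace ℝ E] [FiniteDimensional ℝ E]
  [NormedAddCommGroup F] [NormedSpace ℝ F] [FiniteDimensional ℝ F]

/-- An injective linear map on a finite-dimensional space to a space of the same dimension is a
continuous linear equivalence. -/
theorem exists_continuousLinearEquiv_coe_eq {f : E →L[ℝ] F} (hf : ∀ v, f v = 0 → v = 0)
    (h : Module.finrank ℝ E = Module.finrank ℝ F) : ∃ e : E ≃L[ℝ] F, f = e := by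
  refine ⟨(LinearEquiv.ofInjectiveOfFinrankEq (f : E →ₗ[ℝ] F)
    ((injective_iff_map_eq_zero _).2 hf) h).toContinuousLinearEquiv, ?_⟩
  ext v
  rfl

/-- If the derivative of a smooth map is nowhere surjective, then some nonempty open set has an image
with empty interior. -/
theorem exists_interior_image_eq_empty {D : Set E} (hD : IsOpen D) (hne : D.Nonempty) {H : E → F}
    (hH : ContDiffOn ℝ ∞ H D) (hns : ∀ q ∈ D, ¬ Function.Surjective (fderiv ℝ H q)) :
    ∃ D' ⊆ D, IsOpen D' ∧ D'.Nonempty ∧ interior (H '' D') = ∅ := by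
  let ρ : E → ℕ := fun q => Module.finrank ℝ (fderiv ℝ H q).range
  obtain ⟨q₀, hq₀, hmax⟩ : ∃ q₀ ∈ D, ∀ q ∈ D, ρ q ≤ ρ q₀ := by
    have hb : BddAbove (ρ '' D) := ⟨Module.finrank ℝ F, by
      rintro _ ⟨q, -, rfl⟩
      exact Submodule.finrank_le _⟩
    obtain ⟨q₀, hq₀, h⟩ := Nat.sSup_mem (hne.image ρ) hb
    exact ⟨q₀, hq₀, fun q hq => h ▸ le_csSup hb ⟨q, hq, rfl⟩⟩
  have hHd : ∀ q ∈ D, HasFDerivAt H (fderiv ℝ H q) q := fun q hq =>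
    ((hH.contDiffAt (hD.mem_nhds hq)).differentiableAt (by simp)).hasFDerivAt
  let R := (fderiv ℝ H q₀).range
  let K := (fderiv ℝ H q₀).ker
  obtain ⟨P, hP⟩ := exists_projection R
  obtain ⟨L, hL⟩ := exists_projection K
  -- At a point `q₀` of maximal rank, project `H` to the range of its derivative and add coordinates
  -- along the kernel; this gives a chart in which `H` will depend on the `R` coordinate alone.
  let Φ : E → R × K := fun q => (P (H q), L q)
  have hΦd : ∀ q ∈ D, HasFDerivAt Φ ((P.comp (fderiv ℝ H q)).prod L) q := fun q hq =>
    (P.hasFDerivAt.comp q (hHd q hq)).prodMk L.hasFDerivAt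
  have hΦs : ContDiffOn ℝ ∞ Φ D :=
    (P.contDiff.comp_contDiffOn hH).prodMk L.contDiff.contDiffOn
  obtain ⟨Φ', hΦ'⟩ := exists_continuousLinearEquiv_coe_eq
    (f := (P.comp (fderiv ℝ H q₀)).prod L) (by
      intro v hv
      have h1 : P (fderiv ℝ H q₀ v) = 0 := congrArg Prod.fst hv
      have h2 : L v = 0 := congrArg Prod.snd hv
      have h3 := hP ⟨fderiv ℝ H q₀ v, ⟨v, rfl⟩⟩
      rw [h1] at h3
      have h4 : fderiv ℝ H q₀ v = 0 := congrArg Subtype.val h3.symm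
      have h5 := hL ⟨v, h4⟩
      rw [h2] at h5
      exact congrArg Subtype.val h5.symm)
    (by
      rw [Module.finrank_prod]
      exact (LinearMap.finrank_range_add_finrank_ker (fderiv ℝ H q₀ : E →ₗ[ℝ] F)).symm)
  obtain ⟨e, he, hqe, heD, heq, hes⟩ := exists_openPartialHomeomorph_of_fderiv hD hΦs hq₀ Φ'
    ((hΦd q₀ hq₀).fderiv.trans hΦ')
  obtain ⟨ε, hε, hball⟩ := Metric.isOpen_iff.1 e.open_target _ (e.map_source hqe)
  let B := Metric.ball (e q₀) ε
  have hder : ∀ p ∈ B, DifferentiableAt ℝ (H ∘ e.symm) p ∧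
      ∀ κ : K, fderiv ℝ (H ∘ e.symm) p (0, κ) = 0 := by
    intro p hp
    have hq : e.symm p ∈ e.source := e.map_target (hball hp)
    have hsd : HasFDerivAt e.symm (fderiv ℝ e.symm p) p :=
      ((hes.contDiffAt (e.open_target.mem_nhds (hball hp))).differentiableAt
        (by simp)).hasFDerivAt
    have hcomp := (hHd _ (heD hq)).comp p hsd
    refine ⟨hcomp.differentiableAt, fun κ => ?_⟩
    rw [hcomp.fderiv]
    set v := fderiv ℝ e.symm p (0, κ)
    change fderiv ℝ H (e.symm p) v = 0
    have h1 : P (fderiv ℝ H (e.symm p) v) = 0 := by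
      have h2 := (hΦd _ (heD hq)).comp p hsd
      have h3 : (Φ ∘ e.symm) =ᶠ[nhds p] id := by
        filter_upwards [e.open_target.mem_nhds (hball hp)] with p' hp'
        have := e.right_inv hp'
        rwa [he] at this
      have h4 := h2.unique ((hasFDerivAt_id p).congr_of_eventuallyEq h3)
      have h5 := DFunLike.congr_fun h4 ((0, κ) : R × K)
      exact congrArg Prod.fst h5
    obtain ⟨f₁, hf₁⟩ := heq _ hq
    rw [(hΦd _ (heD hq)).fderiv] at hf₁
    -- `P` maps the range at a nearby point onto `R`; as the rank there is at most the rank at `q₀`,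
    -- it is injective on that range, so `P (dH v) = 0` forces `dH v = 0`.
    let T : (fderiv ℝ H (e.symm p)).range →ₗ[ℝ] R :=
      (P : F →ₗ[ℝ] R).comp (Submodule.subtype _)
    have hsurj : Function.Surjective T := by
      intro b
      have h6 := f₁.apply_symm_apply (b, 0)
      have h7 : ((P.comp (fderiv ℝ H (e.symm p))).prod L) (f₁.symm (b, 0)) = (b, 0) := by
        rw [hf₁]; exact h6
      exact ⟨⟨_, ⟨f₁.symm (b, 0), rfl⟩⟩, congrArg Prod.fst h7⟩
    have hinj : Function.Injective T :=
      (LinearMap.injective_iff_surjective_of_finrank_eq_finrank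
        (le_antisymm (hmax _ (heD hq)) (LinearMap.finrank_le_finrank_of_surjective hsurj))).2 hsurj
    have h8 : (⟨fderiv ℝ H (e.symm p) v, ⟨v, rfl⟩⟩ : (fderiv ℝ H (e.symm p)).range) = 0 :=
      hinj (by rw [map_zero]; exact h1)
    exact congrArg Subtype.val h8
  refine ⟨e.source ∩ e ⁻¹' B, fun q hq => heD hq.1, e.isOpen_inter_preimage Metric.isOpen_ball,
    ⟨q₀, hqe, Metric.mem_ball_self hε⟩, ?_⟩
  -- In the chart, two points with equal `P ∘ H` differ only along `K`, where `H` is constant. So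
  -- `P` is injective on the image, which excludes two image points differing by a nonzero element
  -- of the kernel of `P`.
  have hPinj : ∀ q₁ ∈ e.source ∩ e ⁻¹' B, ∀ q₂ ∈ e.source ∩ e ⁻¹' B,
      P (H q₁) = P (H q₂) → H q₁ = H q₂ := by
    intro q₁ h₁ q₂ h₂ h
    have h3 := eq_of_fderiv_sub_eq_zero (convex_ball (e q₀) ε) (fun p hp => (hder p hp).1)
      h₁.2 h₂.2 (fun p hp => by
        have h4 : e q₂ - e q₁ = (0, L q₂ - L q₁) := by
          rw [he]
          refine Prod.ext ?_ rfl
          change P (H q₂) - P (H q₁) = 0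
          rw [h, sub_self]
        rw [h4]
        exact (hder p hp).2 _)
    simpa [e.left_inv h₁.1, e.left_inv h₂.1] using h3
  rw [Set.eq_empty_iff_forall_notMem]
  intro o ho
  obtain ⟨k, hk, hk0⟩ : ∃ k, P k = 0 ∧ k ≠ 0 := by
    have hlt : Module.finrank ℝ R < Module.finrank ℝ F := by
      refine Submodule.finrank_lt fun h => hns q₀ hq₀ ?_
      exact LinearMap.range_eq_top.1 h
    obtain ⟨k, hk, hk0⟩ := Submodule.exists_mem_ne_zero_of_ne_bot
      (LinearMap.ker_ne_bot_of_finrank_lt (f := (P : F →ₗ[ℝ] R)) hlt)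
    exact ⟨k, hk, hk0⟩
  have hc : Filter.Tendsto (fun τ : ℝ => o + τ • k) (nhdsWithin 0 {0}ᶜ) (nhds o) := by
    have : Continuous fun τ : ℝ => o + τ • k := by fun_prop
    have h := this.tendsto 0
    simp only [zero_smul, add_zero] at h
    exact h.mono_left nhdsWithin_le_nhds
  obtain ⟨τ, hτ, hτ0⟩ := ((hc.eventually (isOpen_interior.mem_nhds ho)).and
    self_mem_nhdsWithin).exists
  obtain ⟨q₁, h₁, rfl⟩ := interior_subset ho
  obtain ⟨q₂, h₂, h⟩ := interior_subset hτ
  have h3 := hPinj q₁ h₁ q₂ h₂ (by rw [h, map_add, map_smul, hk, smul_zero, add_zero])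
  rw [h] at h3
  exact (smul_ne_zero hτ0 hk0) (by simpa using h3)

end Rank

/-! ### Existence of trajectories -/

section Existence

variable {X U : Type} [NormedAddCommGroup X] [NormedSpace ℝ X] [CompleteSpace X]
  [NormedAddCommGroup U] [NormedSpace ℝ U]

/-- For every smooth control there is a trajectory through every point of the domain. -/
theorem exists_isTrajectory (S : ControlSystem X U) {u : ℝ → U} (hu : ContDiff ℝ ∞ u) {t : ℝ}
    {x₀ : X} (h : (t, x₀, u t) ∈ S.domain) :
    ∃ (I : Set ℝ) (x : ℝ → X), t ∈ I ∧ x t = x₀ ∧ S.IsTrajectory I x u := by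
  -- Time is added to the state to make the equation autonomous.
  let v : ℝ × X → ℝ × X := fun p => (1, S.f (p.1, p.2, u p.1))
  have hv : ContDiffAt ℝ 1 v (t, x₀) := by
    refine contDiffAt_const.prodMk (ContDiffAt.comp (t, x₀) (g := S.f)
      (f := fun p : ℝ × X => (p.1, p.2, u p.1)) ?_ ?_)
    · exact (S.smooth_f.contDiffAt (S.isOpen_domain.mem_nhds h)).of_le (by simp)
    · refine ContDiff.contDiffAt ?_
      have := hu.of_le (m := 1) (by simp)
      fun_prop
  obtain ⟨α, hα, ε, hε, hα'⟩ :=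
    hv.exists_forall_mem_closedBall_exists_eq_forall_mem_Ioo_hasDerivAt₀ t
  let J := Set.Ioo (t - ε) (t + ε)
  have htJ : t ∈ J := ⟨by linarith, by linarith⟩
  have h1 : ∀ s ∈ J, (α s).1 = s := by
    intro s hs
    have hd : ∀ s ∈ J, HasDerivAt (fun s => (α s).1 - s) 0 s := fun s hs => by
      have h : HasDerivAt (fun s => (α s).1) 1 s := (hα' s hs).fst
      simpa using! h.sub (hasDerivAt_id s)
    have := isOpen_Ioo.is_const_of_deriv_eq_zero isPreconnected_Ioo
      (fun s hs => (hd s hs).differentiableAt.differentiableWithinAt)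
      (fun s hs => (hd s hs).deriv) hs htJ
    rw [hα] at this
    simp at this
    linarith
  have h2 : ∀ s ∈ J, HasDerivAt (fun s => (α s).2) (S.f (s, (α s).2, u s)) s := by
    intro s hs
    have := (hα' s hs).snd
    simpa only [v, h1 s hs] using! this
  have hcont : ContinuousOn (fun s => (s, (α s).2, u s)) J := fun s hs =>
    (continuousAt_id.prodMk ((h2 s hs).continuousAt.prodMk
      hu.continuous.continuousAt)).continuousWithinAt
  let I := J ∩ (fun s => (s, (α s).2, u s)) ⁻¹' S.domain
  have hI : IsOpen I := hcont.isOpen_inter_preimage isOpen_Ioo S.isOpen_domain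
  refine ⟨I, fun s => (α s).2, ⟨htJ, ?_⟩, by simp [hα], hI, ?_, hu.contDiffOn,
    fun s hs => ⟨hs.2, h2 s hs.1⟩⟩
  · simpa [hα] using h
  · rw [contDiffOn_infty]
    intro k
    -- Bootstrapping: if the solution is `C^k`, the right-hand side of the equation is `C^k`, so the
    -- solution is `C^(k+1)`.
    induction k with
    | zero =>
      exact contDiffOn_zero.2 fun s hs => (h2 s hs.1).continuousAt.continuousWithinAt
    | succ k ih =>
      push_cast
      rw [contDiffOn_succ_iff_deriv_of_isOpen hI]
      refine ⟨fun s hs => (h2 s hs.1).differentiableAt.differentiableWithinAt, by simp, ?_⟩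
      refine ContDiffOn.congr (f := fun s => S.f (s, (α s).2, u s)) ?_
        fun s hs => (h2 s hs.1).deriv
      exact (S.smooth_f.of_le (mod_cast le_top)).comp
        (contDiffOn_id.prodMk (ih.prodMk (hu.contDiffOn.of_le (mod_cast le_top)))) fun s hs => hs.2

end Existence

/-- In every nonempty open set of jets of trajectories there is a trajectory, through any state
that occurs in it. -/
theorem exists_isTrajectory_trajectoryJet_mem {n m : ℕ}
    (S : ControlSystem (Fin n → ℝ) (Fin m → ℝ)) {V : Set (TrajectoryJet n m)} (hV : IsOpen V)
    (hVS : V ⊆ S.jets) {ζ : TrajectoryJet n m} (hζ : ζ ∈ V) :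
    ∃ (I : Set ℝ) (x : ℝ → Fin n → ℝ) (u : ℝ → Fin m → ℝ), S.IsTrajectory I x u ∧
      (∀ t ∈ I, trajectoryJet x u t ∈ V) ∧ ζ.1 ∈ I ∧ x ζ.1 = ζ.2.1 := by
  -- In the product topology the truncations of a jet converge to it, so one of them lies in `V`; a
  -- truncated jet is realized by a polynomial control.
  have hlim : Filter.Tendsto (fun N : ℕ => ((ζ.1, ζ.2.1, fun j => if j < N then ζ.2.2 j else 0) :
      TrajectoryJet n m)) Filter.atTop (nhds ζ) := by
    refine tendsto_const_nhds.prodMk_nhds (tendsto_const_nhds.prodMk_nhds (tendsto_pi_nhds.2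
      fun j => tendsto_const_nhds.congr' ?_))
    filter_upwards [Filter.eventually_gt_atTop j] with N hN
    simp [hN]
  obtain ⟨N, hN⟩ := (hlim.eventually (hV.mem_nhds hζ)).exists
  obtain ⟨u, hu, huj⟩ := exists_contDiff_iteratedDeriv_eq ζ.1 N ζ.2.2
  have hju : (ζ.1, ζ.2.1, fun j => iteratedDeriv j u ζ.1) ∈ V := by
    simp only [huj]; exact hN
  have hdom : (ζ.1, ζ.2.1, u ζ.1) ∈ S.domain := by simpa [jets] using hVS hju
  obtain ⟨I, x, htI, hx, hT⟩ := S.exists_isTrajectory hu hdom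
  have hc : ContinuousOn (trajectoryJet x u) I := by
    refine continuousOn_id.prodMk (hT.2.1.continuousOn.prodMk (continuousOn_pi.2 fun j => ?_))
    exact (contDiffOn_iteratedDeriv hT.1 hu.contDiffOn j).continuousOn
  have hsub : I ∩ trajectoryJet x u ⁻¹' V ⊆ I := Set.inter_subset_left
  refine ⟨I ∩ trajectoryJet x u ⁻¹' V, x, u, ⟨hc.isOpen_inter_preimage hT.1 hV,
    hT.2.1.mono hsub, hT.2.2.1.mono hsub, fun s hs => hT.2.2.2 s hs.1⟩, fun s hs => hs.2,
    ⟨htI, ?_⟩, hx⟩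
  rw [Set.mem_preimage, trajectoryJet, hx]
  exact hju

/-! ### Static feedback transformations and their action on trajectories -/

namespace IsStaticFeedbackTransformation

variable {X U Z W : Type}
  [NormedAddCommGroup X] [NormedSpace ℝ X] [NormedAddCommGroup U] [NormedSpace ℝ U]
  [NormedAddCommGroup Z] [NormedSpace ℝ Z] [NormedAddCommGroup W] [NormedSpace ℝ W]
  {S : ControlSystem X U} {S' : ControlSystem Z W} {D : Set (ℝ × Z × W)}
  {θ : ℝ × Z → X} {ψ : ℝ × Z × W → U} {I : Set ℝ}

theorem contDiffAt_feedbackMap (h : S.IsStaticFeedbackTransformation S' D θ ψ)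
    {q : ℝ × Z × W} (hq : q ∈ D) : ContDiffAt ℝ ∞ (feedbackMap θ ψ) q := by
  obtain ⟨Ψ, hqΨ, heq⟩ := h.2.2.2.1 ⟨q, hq⟩
  refine (Ψ.contMDiffOn_toFun.contDiffOn.contDiffAt
    (Ψ.open_source.mem_nhds hqΨ)).congr_of_eventuallyEq ?_
  exact heq.eventuallyEq_of_mem (Ψ.open_source.mem_nhds hqΨ)

theorem contDiffOn_feedbackMap (h : S.IsStaticFeedbackTransformation S' D θ ψ) :
    ContDiffOn ℝ ∞ (feedbackMap θ ψ) D := fun _ hq =>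
  (h.contDiffAt_feedbackMap hq).contDiffWithinAt

theorem exists_fderiv_feedbackMap_eq (h : S.IsStaticFeedbackTransformation S' D θ ψ)
    {q : ℝ × Z × W} (hq : q ∈ D) :
    ∃ e : (ℝ × Z × W) ≃L[ℝ] (ℝ × X × U), fderiv ℝ (feedbackMap θ ψ) q = e := by
  refine ⟨(h.2.2.2.1 ⟨q, hq⟩).mfderivToContinuousLinearEquiv (by simp), ?_⟩
  have := (h.2.2.2.1 ⟨q, hq⟩).mfderivToContinuousLinearEquiv_coe (by simp)
  rw [← mfderiv_eq_fderiv]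
  exact this.symm

theorem contDiffAt_state (h : S.IsStaticFeedbackTransformation S' D θ ψ)
    {q : ℝ × Z × W} (hq : q ∈ D) : ContDiffAt ℝ ∞ θ (q.1, q.2.1) := by
  have h1 : ContDiffAt ℝ ∞ (fun p : ℝ × Z => (p.1, p.2, q.2.2)) (q.1, q.2.1) := by
    refine ContDiff.contDiffAt ?_
    fun_prop
  have h2 := ContDiffAt.comp (q.1, q.2.1) (h.contDiffAt_feedbackMap hq) h1
  exact h2.snd.fst

theorem hasFDerivAt_state (h : S.IsStaticFeedbackTransformation S' D θ ψ)
    {q : ℝ × Z × W} (hq : q ∈ D) : HasFDerivAt θ (fderiv ℝ θ (q.1, q.2.1)) (q.1, q.2.1) :=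
  ((h.contDiffAt_state hq).differentiableAt (by simp)).hasFDerivAt

theorem isTrajectory (h : S.IsStaticFeedbackTransformation S' D θ ψ) {z : ℝ → Z} {v : ℝ → W}
    (hT : S'.IsTrajectory I z v) (hD : ∀ t ∈ I, (t, z t, v t) ∈ D) :
    S.IsTrajectory I (fun t => θ (t, z t)) (fun t => ψ (t, z t, v t)) := by
  have hs : ContDiffOn ℝ ∞ (fun t => feedbackMap θ ψ (t, z t, v t)) I :=
    h.contDiffOn_feedbackMap.comp (contDiffOn_id.prodMk (hT.2.1.prodMk hT.2.2.1)) hD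
  refine ⟨hT.1, hs.snd.fst, hs.snd.snd, fun t ht => ⟨h.2.2.1 (hD t ht), ?_⟩⟩
  have := (h.hasFDerivAt_state (hD t ht)).comp_hasDerivAt t
    ((hasDerivAt_id t).prodMk (hT.2.2.2 t ht).2)
  rwa [h.2.2.2.2 _ (hD t ht)] at this

/-- Since `t` is preserved and `θ` does not involve `v`, invertibility of the full derivative makes
`∂θ/∂z` surjective. Equal control dimensions force equal state dimensions, so `∂θ/∂z` is also
injective. -/
theorem state_injective [FiniteDimensional ℝ X] [FiniteDimensional ℝ U] [FiniteDimensional ℝ Z]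
    [FiniteDimensional ℝ W] (hWU : Module.finrank ℝ W = Module.finrank ℝ U)
    (h : S.IsStaticFeedbackTransformation S' D θ ψ) {q : ℝ × Z × W} (hq : q ∈ D) {ζ : Z}
    (hζ : fderiv ℝ θ (q.1, q.2.1) (0, ζ) = 0) : ζ = 0 := by
  obtain ⟨e, he⟩ := h.exists_fderiv_feedbackMap_eq hq
  have hdim : Module.finrank ℝ Z = Module.finrank ℝ X := by
    have := e.toLinearEquiv.finrank_eq
    simp only [Module.finrank_prod, hWU] at this
    omega
  let T : Z →ₗ[ℝ] X := (fderiv ℝ θ (q.1, q.2.1) : ℝ × Z →ₗ[ℝ] X).comp (LinearMap.inr ℝ ℝ Z)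
  have hsurj : Function.Surjective T := by
    intro ξ
    have h1 : HasFDerivAt (feedbackMap θ ψ) (e : (ℝ × Z × W) →L[ℝ] (ℝ × X × U)) q := by
      rw [← he]
      exact ((h.contDiffAt_feedbackMap hq).differentiableAt (by simp)).hasFDerivAt
    set κ := e.symm (0, ξ, 0) with hκ
    have h2 : e κ = (0, ξ, 0) := e.apply_symm_apply _
    have h3 := h1.fst.unique (hasFDerivAt_fst (𝕜 := ℝ) (p := q))
    have h4 : HasFDerivAt (fun q : ℝ × Z × W => θ (q.1, q.2.1)) _ q :=
      HasFDerivAt.comp q (f := fun q : ℝ × Z × W => (q.1, q.2.1)) (h.hasFDerivAt_state hq)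
        (hasFDerivAt_fst.prodMk hasFDerivAt_snd.fst)
    have h5 := h1.snd.fst.unique h4
    have h6 : (e κ).1 = κ.1 := DFunLike.congr_fun h3 κ
    have h7 : (e κ).2.1 = fderiv ℝ θ (q.1, q.2.1) (κ.1, κ.2.1) := DFunLike.congr_fun h5 κ
    rw [h2] at h6 h7
    refine ⟨κ.2.1, ?_⟩
    rw [← h6] at h7
    exact h7.symm
  exact (injective_iff_map_eq_zero T).1
    ((LinearMap.injective_iff_surjective_of_finrank_eq_finrank hdim).2 hsurj) ζ hζ

/-- Trajectories near a point of the image of a static feedback transformation come from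
trajectories of the transformed system. -/
theorem exists_lift [FiniteDimensional ℝ X] [FiniteDimensional ℝ U] [FiniteDimensional ℝ Z]
    [FiniteDimensional ℝ W] (hWU : Module.finrank ℝ W = Module.finrank ℝ U)
    (h : S.IsStaticFeedbackTransformation S' D θ ψ) {D' : Set (ℝ × Z × W)} (hD' : IsOpen D')
    (hne : D'.Nonempty) (hsub : D' ⊆ D) :
    ∃ N ⊆ S.domain, IsOpen N ∧ N.Nonempty ∧ ∀ (J : Set ℝ) (x : ℝ → X) (u : ℝ → U),
      S.IsTrajectory J x u → (∀ t ∈ J, (t, x t, u t) ∈ N) →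
      ∃ (z : ℝ → Z) (v : ℝ → W), S'.IsTrajectory J z v ∧ ∀ t ∈ J, (t, z t, v t) ∈ D' ∧
        feedbackMap θ ψ (t, z t, v t) = (t, x t, u t) := by
  obtain ⟨q₀, hq₀⟩ := hne
  obtain ⟨Ψ, hqΨ, heq⟩ := h.2.2.2.1 ⟨q₀, hsub hq₀⟩
  have hinv : ContDiffOn ℝ ∞ Ψ.invFun Ψ.target := Ψ.contMDiffOn_invFun.contDiffOn
  have hΨ : ∀ p ∈ Ψ.target, feedbackMap θ ψ (Ψ.invFun p) = p := fun p hp =>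
    (heq (Ψ.map_target hp)).trans (Ψ.right_inv hp)
  refine ⟨Ψ.target ∩ Ψ.invFun ⁻¹' D', ?_,
    hinv.continuousOn.isOpen_inter_preimage Ψ.open_target hD', ?_, ?_⟩
  · rintro p ⟨hp, hp'⟩
    rw [← hΨ p hp]
    exact h.2.2.1 (hsub hp')
  · refine ⟨Ψ.toFun q₀, Ψ.map_source hqΨ, ?_⟩
    have : Ψ.invFun (Ψ.toFun q₀) = q₀ := Ψ.left_inv hqΨ
    rwa [Set.mem_preimage, this]
  intro J x u hT hN
  let q : ℝ → ℝ × Z × W := fun t => Ψ.invFun (t, x t, u t)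
  have hqs : ContDiffOn ℝ ∞ q J :=
    hinv.comp (contDiffOn_id.prodMk (hT.2.1.prodMk hT.2.2.1)) fun t ht => (hN t ht).1
  have hq : ∀ t ∈ J, feedbackMap θ ψ (q t) = (t, x t, u t) := fun t ht => hΨ _ (hN t ht).1
  have hq1 : ∀ t ∈ J, (t, (q t).2.1, (q t).2.2) = q t := fun t ht =>
    Prod.ext (congrArg Prod.fst (hq t ht)).symm rfl
  have hqD : ∀ t ∈ J, q t ∈ D' := fun t ht => (hN t ht).2
  refine ⟨fun t => (q t).2.1, fun t => (q t).2.2,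
    ⟨hT.1, hqs.snd.fst, hqs.snd.snd, fun t ht => ?_⟩, fun t ht => ?_⟩
  swap
  · rw [hq1 t ht]
    exact ⟨hqD t ht, hq t ht⟩
  rw [hq1 t ht]
  refine ⟨h.2.1 (hsub (hqD t ht)), ?_⟩
  have hz : HasDerivAt (fun t => (q t).2.1) (deriv (fun t => (q t).2.1) t) t :=
    ((hqs.snd.fst.contDiffAt (hT.1.mem_nhds ht)).differentiableAt (by simp)).hasDerivAt
  have ht1 : (q t).1 = t := (congrArg Prod.fst (hq t ht))
  have hθ : HasFDerivAt θ (fderiv ℝ θ (t, (q t).2.1)) (t, (q t).2.1) := by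
    have := h.hasFDerivAt_state (hsub (hqD t ht))
    rwa [ht1] at this
  have h1 : HasDerivAt (fun s => θ (s, (q s).2.1))
      (fderiv ℝ θ (t, (q t).2.1) (1, deriv (fun t => (q t).2.1) t)) t :=
    hθ.comp_hasDerivAt t ((hasDerivAt_id t).prodMk hz)
  have h2 : (fun s => θ (s, (q s).2.1)) =ᶠ[nhds t] x := by
    filter_upwards [hT.1.mem_nhds ht] with s hs
    have := congrArg (fun p => p.2.1) (hq s hs)
    rw [← hq1 s hs] at this
    exact this
  have h3 := (h1.congr_of_eventuallyEq h2.symm).unique (hT.2.2.2 t ht).2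
  have h4 := h.2.2.2.2 _ (hsub (hqD t ht))
  rw [hq t ht, ← h3, ht1] at h4
  -- Differentiating `θ(t, z(t)) = x(t)` shows that `ż` and `S'.f` have the same image under
  -- `∂θ/∂z`.
  have h5 : S'.f (q t) - deriv (fun t => (q t).2.1) t = 0 := by
    refine h.state_injective hWU (hsub (hqD t ht)) ?_
    have h6 : ((0, S'.f (q t) - deriv (fun t => (q t).2.1) t) : ℝ × Z) =
        (1, S'.f (q t)) - (1, deriv (fun t => (q t).2.1) t) := by simp
    rw [h6, map_sub, ht1, h4, sub_self]
  rw [sub_eq_zero.1 h5]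
  exact hz

end IsStaticFeedbackTransformation

/-! ### Trajectories of the Brunovsky system -/

section Brunovsky

variable {m : ℕ} {r : Fin m → ℕ} {I : Set ℝ}

theorem isTrajectory_brunovsky_functionJet {z : ℝ → Fin m → ℝ} (hI : IsOpen I)
    (hz : ContDiffOn ℝ ∞ z I) :
    (brunovsky r).IsTrajectory I (fun t => ((jetEquiv r).symm (functionJet r z t)).2.1)
      (fun t => ((jetEquiv r).symm (functionJet r z t)).2.2) := by
  have hs := contDiffOn_jetEquiv_symm_functionJet (r := r) hI hz
  refine ⟨hI, hs.snd.fst, hs.snd.snd, fun t ht => ⟨Set.mem_univ _, ?_⟩⟩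
  exact (hasDerivAt_jetEquiv_symm_functionJet hI hz ht).snd.fst

/-- Trajectories of a system in Brunovsky normal form are jets of functions. -/
theorem IsTrajectory.functionJet_eq (hr : ∀ a, 1 ≤ r a)
    {z : ℝ → (a : Fin m) → Fin (r a) → ℝ} {v : ℝ → Fin m → ℝ}
    (hT : (brunovsky r).IsTrajectory I z v) {t : ℝ} (ht : t ∈ I) :
    functionJet r (fun s a => z s a ⟨0, hr a⟩) t = jetEquiv r (t, z t, v t) := by
  have hz : ∀ a l, ∀ t ∈ I, HasDerivAt (fun s => z s a l)
      ((brunovsky r).f (t, z t, v t) a l) t := fun a l t ht =>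
    hasDerivAt_pi.1 (hasDerivAt_pi.1 (hT.2.2.2 t ht).2 a) l
  have hit : ∀ a l (hl : l < r a), ∀ t ∈ I,
      iteratedDeriv l (fun s => z s a ⟨0, hr a⟩) t = z t a ⟨l, hl⟩ := by
    intro a l
    induction l with
    | zero => intro hl t _; simp
    | succ l ih =>
      intro hl t ht
      rw [iteratedDeriv_succ]
      have h1 : iteratedDeriv l (fun s => z s a ⟨0, hr a⟩) =ᶠ[nhds t]
          fun s => z s a ⟨l, by omega⟩ := by
        filter_upwards [hT.1.mem_nhds ht] with s hs using ih (by omega) s hs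
      rw [h1.deriv_eq, (hz a _ t ht).deriv]
      simp [brunovsky, hl]
  have htop : ∀ a, iteratedDeriv (r a) (fun s => z s a ⟨0, hr a⟩) t = v t a := by
    intro a
    obtain ⟨l, hl⟩ : ∃ l, r a = l + 1 := ⟨r a - 1, by have := hr a; omega⟩
    have hl' : l < r a := by omega
    have h1 : iteratedDeriv l (fun s => z s a ⟨0, hr a⟩) =ᶠ[nhds t] fun s => z s a ⟨l, hl'⟩ := by
      filter_upwards [hT.1.mem_nhds ht] with s hs using hit a l hl' s hs
    -- The type of `z` depends on `r a`, so `r a = l + 1` is substituted in the operator alone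
    -- rather than in the goal.
    have hsucc : iteratedDeriv (r a) = fun g : ℝ → ℝ => deriv (iteratedDeriv l g) := by
      funext g
      rw [hl, iteratedDeriv_succ]
    rw [hsucc]
    beta_reduce
    rw [h1.deriv_eq, (hz a _ t ht).deriv]
    simp [brunovsky, ← hl]
  rw [← (jetEquiv r).symm_apply_eq, jetEquiv_symm_apply]
  refine Prod.ext rfl (Prod.ext (funext fun a => funext fun l => ?_) (funext fun a => ?_))
  · exact hit a l l.2 t ht
  · exact htop a

end Brunovsky

/-! ### From dynamic feedback linearizability to explicit integrability -/

theorem IsDynamicFeedbackLinearizable.isExplicitlyIntegrable {n m : ℕ}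
    {S : ControlSystem (Fin n → ℝ) (Fin m → ℝ)} (hS : S.IsDynamicFeedbackLinearizable) :
    S.IsExplicitlyIntegrable := by
  intro V₀ hV₀ hne hsub
  obtain ⟨k, m', F, ⟨p, hp⟩, ⟨rfl, hF⟩, hlin⟩ := hS V₀ hV₀ hne hsub
  obtain ⟨r, hr, D, θ, ψ, h, q, hq, -⟩ := hlin p hp
  have hcont := (jetEquiv r).symm.continuous
  have hsm : ContDiffOn ℝ ∞ (fun j => feedbackMap θ ψ ((jetEquiv r).symm j))
      ((jetEquiv r).symm ⁻¹' D) :=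
    h.contDiffOn_feedbackMap.comp (jetEquiv r).symm.contDiff.contDiffOn fun j hj => hj
  refine ⟨r, (jetEquiv r).symm ⁻¹' D, fun j => (feedbackMap θ ψ ((jetEquiv r).symm j)).2.1.1,
    fun j => F.β (feedbackMap θ ψ ((jetEquiv r).symm j)), ⟨h.1.preimage hcont,
      ⟨jetEquiv r q, by simpa using hq⟩, hr, hsm.snd.fst.fst,
      F.smooth_β.comp hsm fun j hj => h.2.2.1 hj, fun I z hI hz hD => ?_⟩, ?_⟩
  · have hT := h.isTrajectory (isTrajectory_brunovsky_functionJet hI hz) hD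
    refine ⟨hI, hT.2.1.fst, ?_, fun t ht => ⟨F.mem_domain _ (hT.2.2.2 t ht).1,
      (hT.2.2.2 t ht).2.fst⟩⟩
    exact F.smooth_β.comp (contDiffOn_id.prodMk (hT.2.1.prodMk hT.2.2.1)) fun t ht =>
      (hT.2.2.2 t ht).1
  · intro D' hD' hopen hne'
    -- `D'` determines an open `N` in the augmented domain, and solution correspondence turns `N`
    -- into `V`.
    obtain ⟨N, hN, hNo, hNne, hlift⟩ := h.exists_lift rfl
      (hopen.preimage (jetEquiv r).continuous)
      (by
        obtain ⟨j, hj⟩ := hne'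
        exact ⟨(jetEquiv r).symm j, by simpa using hj⟩)
      (fun q hq => by simpa using hD' hq)
    obtain ⟨V, hV, hVo, hVne, hVl⟩ := hF N hN hNo hNne
    refine ⟨V, hV, hVo, hVne, fun I x u hT hIV t₀ ht₀ => ?_⟩
    obtain ⟨J, hJ, htJ, hJI, y, w, hTa, hJN⟩ := hVl I x u hT hIV t₀ ht₀
    obtain ⟨z, v, hTz, hz⟩ := hlift J _ w hTa fun t ht => (hJN t ht).1
    refine ⟨J, hJ, htJ, hJI, fun s a => z s a ⟨0, hr a⟩, ?_, fun t ht => ?_⟩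
    · exact contDiffOn_pi.2 fun a => contDiffOn_pi.1 (contDiffOn_pi.1 hTz.2.1 a) _
    · rw [hTz.functionJet_eq hr ht]
      refine ⟨(hz t ht).1, ?_, ?_⟩
      · simp only [ContinuousLinearEquiv.symm_apply_apply, (hz t ht).2]
      · simp only [ContinuousLinearEquiv.symm_apply_apply, (hz t ht).2]
        exact (hJN t ht).2

/-! ### From explicit integrability to dynamic feedback linearizability -/

/-- If `A(t, z, v)` does not depend on `v` to first order and `(t, A)` is a submersion at a point,
then locally finitely many linear functions of `z` complete `(t, A, v)` to a system of
coordinates. -/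
theorem exists_chart {X Z W : Type} [NormedAddCommGroup X] [NormedSpace ℝ X]
    [FiniteDimensional ℝ X] [NormedAddCommGroup Z] [NormedSpace ℝ Z] [FiniteDimensional ℝ Z]
    [NormedAddCommGroup W] [NormedSpace ℝ W] [FiniteDimensional ℝ W]
    {A : ℝ × Z × W → X} {G : Set (ℝ × Z × W)} (hG : IsOpen G) (hA : ContDiffOn ℝ ∞ A G)
    (hAw : ∀ q ∈ G, ∀ w, fderiv ℝ A q (0, 0, w) = 0) {q₀ : ℝ × Z × W} (hq₀ : q₀ ∈ G)
    (hsurj : Function.Surjective (fderiv ℝ (fun q : ℝ × Z × W => (q.1, A q)) q₀)) :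
    ∃ (k : ℕ) (L : Z →L[ℝ] (Fin k → ℝ)) (A₁ : ℝ × Z → X)
      (e : OpenPartialHomeomorph (ℝ × Z × W) (ℝ × (X × (Fin k → ℝ)) × W)),
      q₀ ∈ e.source ∧ e.source ⊆ G ∧ (∀ q, e q = (q.1, (A q, L q.2.1), q.2.2)) ∧
      ContDiffOn ℝ ∞ e.symm e.target ∧ ∀ q ∈ e.source, A₁ (q.1, q.2.1) = A q := by
  obtain ⟨ε, hε, hball⟩ := Metric.isOpen_iff.1 hG q₀ hq₀
  have hAd : ∀ q ∈ G, HasFDerivAt A (fderiv ℝ A q) q := fun q hq =>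
    ((hA.contDiffAt (hG.mem_nhds hq)).differentiableAt (by simp)).hasFDerivAt
  have hindep : ∀ q ∈ Metric.ball q₀ ε, A (q.1, q.2.1, q₀.2.2) = A q := by
    intro q hq
    have hq' : (q.1, q.2.1, q₀.2.2) ∈ Metric.ball q₀ ε := by
      simp only [Metric.mem_ball, Prod.dist_eq, max_lt_iff] at hq ⊢
      exact ⟨hq.1, hq.2.1, by simpa using hε⟩
    refine eq_of_fderiv_sub_eq_zero (convex_ball q₀ ε)
      (fun p hp => (hAd p (hball hp)).differentiableAt) hq' hq fun p hp => ?_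
    have : q - (q.1, q.2.1, q₀.2.2) = (0, 0, q.2.2 - q₀.2.2) := by
      refine Prod.ext ?_ (Prod.ext ?_ rfl) <;> simp
    rw [this]
    exact hAw p (hball hp) _
  let T : Z →L[ℝ] X := (fderiv ℝ A q₀).comp
    ((ContinuousLinearMap.inr ℝ ℝ (Z × W)).comp (ContinuousLinearMap.inl ℝ Z W))
  have hT : ∀ ζ, T ζ = fderiv ℝ A q₀ (0, ζ, 0) := fun ζ => rfl
  have hTs : Function.Surjective T := by
    intro ξ
    obtain ⟨⟨τ, ζ, η⟩, hv⟩ := hsurj (0, ξ)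
    rw [(hasFDerivAt_fst.prodMk (hAd q₀ hq₀)).fderiv] at hv
    have h1 : τ = 0 := congrArg Prod.fst hv
    have h2 : fderiv ℝ A q₀ (τ, ζ, η) = ξ := congrArg Prod.snd hv
    refine ⟨ζ, ?_⟩
    rw [hT, ← h2, h1]
    have h3 : ((0, ζ, η) : ℝ × Z × W) = (0, ζ, 0) + (0, 0, η) := by simp
    rw [h3, map_add, hAw q₀ hq₀, add_zero]
  obtain ⟨P, hP⟩ := exists_projection T.ker
  let κ : T.ker ≃L[ℝ] (Fin (Module.finrank ℝ T.ker) → ℝ) :=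
    ContinuousLinearEquiv.ofFinrankEq (by simp)
  -- Coordinates on the kernel of `T = ∂A/∂z`: exactly the directions that `A` does not see.
  let L : Z →L[ℝ] (Fin (Module.finrank ℝ T.ker) → ℝ) :=
    (κ : T.ker →L[ℝ] (Fin (Module.finrank ℝ T.ker) → ℝ)).comp P
  let Φ : ℝ × Z × W → ℝ × (X × (Fin (Module.finrank ℝ T.ker) → ℝ)) × W :=
    fun q => (q.1, (A q, L q.2.1), q.2.2)
  have hΦ : ContDiffOn ℝ ∞ Φ (Metric.ball q₀ ε) := by
    refine contDiffOn_fst.prodMk (((hA.mono hball).prodMk ?_).prodMk contDiffOn_snd.snd)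
    exact L.contDiff.comp_contDiffOn contDiffOn_snd.fst
  have hΦd := (hasFDerivAt_fst (𝕜 := ℝ) (p := q₀)).prodMk (((hAd q₀ hq₀).prodMk
    (L.hasFDerivAt.comp q₀ (hasFDerivAt_snd (𝕜 := ℝ) (p := q₀)).fst)).prodMk
    (hasFDerivAt_snd (𝕜 := ℝ) (p := q₀)).snd)
  obtain ⟨Φ', hΦ'⟩ := exists_continuousLinearEquiv_coe_eq (f := fderiv ℝ Φ q₀)
    (by
      rintro ⟨τ, ζ, η⟩ hv
      rw [show fderiv ℝ Φ q₀ = _ from hΦd.fderiv] at hv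
      have h1 : τ = 0 := congrArg Prod.fst hv
      have h2 : fderiv ℝ A q₀ (τ, ζ, η) = 0 := congrArg (fun p => p.2.1.1) hv
      have h3 : κ (P ζ) = 0 := congrArg (fun p => p.2.1.2) hv
      have h4 : η = 0 := congrArg (fun p => p.2.2) hv
      subst h1 h4
      have h5 : P ζ = 0 := by simpa using h3
      have h6 := hP ⟨ζ, h2⟩
      rw [h5] at h6
      have h7 : ζ = 0 := congrArg Subtype.val h6.symm
      rw [h7]
      rfl)
    (by
      have h1 := LinearMap.finrank_range_add_finrank_ker (T : Z →ₗ[ℝ] X)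
      rw [LinearMap.range_eq_top.2 hTs, finrank_top] at h1
      simp only [Module.finrank_prod, Module.finrank_fin_fun]
      rw [← h1])
  obtain ⟨e, he, hqe, hes, -, hei⟩ := exists_openPartialHomeomorph_of_fderiv Metric.isOpen_ball hΦ
    (Metric.mem_ball_self hε) Φ' hΦ'
  exact ⟨_, L, fun p => A (p.1, p.2, q₀.2.2), e, hqe, hes.trans hball, fun q => by rw [he], hei,
    fun q hq => hindep q (hes hq)⟩

namespace IsMongeParametrization

variable {n m : ℕ} {S : ControlSystem (Fin n → ℝ) (Fin m → ℝ)} {r : Fin m → ℕ}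
  {D : Set (FunctionJet r)} {A : FunctionJet r → Fin n → ℝ} {B : FunctionJet r → Fin m → ℝ}

theorem isOpen_preimage (h : S.IsMongeParametrization r D A B) : IsOpen (jetEquiv r ⁻¹' D) :=
  h.isOpen.preimage (jetEquiv r).continuous

theorem contDiffOn_state (h : S.IsMongeParametrization r D A B) :
    ContDiffOn ℝ ∞ (fun q => A (jetEquiv r q)) (jetEquiv r ⁻¹' D) :=
  h.smooth_A.comp (jetEquiv r).contDiff.contDiffOn fun _ hq => hq

theorem hasFDerivAt_state (h : S.IsMongeParametrization r D A B)
    {q : ℝ × ((a : Fin m) → Fin (r a) → ℝ) × (Fin m → ℝ)} (hq : jetEquiv r q ∈ D) :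
    HasFDerivAt (fun q => A (jetEquiv r q)) (fderiv ℝ (fun q => A (jetEquiv r q)) q) q :=
  ((h.contDiffOn_state.contDiffAt (h.isOpen_preimage.mem_nhds hq)).differentiableAt
    (by simp)).hasFDerivAt

/-- The chain rule along a function with jet `q` and arbitrary next derivatives `w`; the right-hand
side is free of `w`. -/
theorem fderiv_state (h : S.IsMongeParametrization r D A B)
    {q : ℝ × ((a : Fin m) → Fin (r a) → ℝ) × (Fin m → ℝ)} (hq : jetEquiv r q ∈ D)
    (w : Fin m → ℝ) : (q.1, A (jetEquiv r q), B (jetEquiv r q)) ∈ S.domain ∧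
      fderiv ℝ (fun q => A (jetEquiv r q)) q (1, (brunovsky r).f q, w) =
        S.f (q.1, A (jetEquiv r q), B (jetEquiv r q)) := by
  obtain ⟨z, hz, hzq, hzw⟩ := exists_functionJet_eq q w
  have hc : Continuous (functionJet r z) := by
    rw [← continuousOn_univ]
    exact (contDiffOn_functionJet isOpen_univ hz.contDiffOn).continuousOn
  have hT := (h.isTrajectory (functionJet r z ⁻¹' D) z (h.isOpen.preimage hc) hz.contDiffOn
    fun t ht => ht).2.2.2 q.1 (by rwa [Set.mem_preimage, hzq])
  beta_reduce at hT
  rw [hzq] at hT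
  refine ⟨hT.1, ?_⟩
  have h1 := hasDerivAt_jetEquiv_symm_functionJet (r := r) isOpen_univ hz.contDiffOn
    (Set.mem_univ q.1)
  rw [hzq, ContinuousLinearEquiv.symm_apply_apply, funext hzw] at h1
  have h3 : (jetEquiv r).symm (functionJet r z q.1) = q := by rw [hzq]; simp
  have h2 := h.hasFDerivAt_state hq
  nth_rewrite 2 [← h3] at h2
  have h4 : HasDerivAt (fun t => A (jetEquiv r ((jetEquiv r).symm (functionJet r z t))))
      (fderiv ℝ (fun q => A (jetEquiv r q)) q (1, (brunovsky r).f q, w)) q.1 :=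
    HasFDerivAt.comp_hasDerivAt (f := fun t => (jetEquiv r).symm (functionJet r z t)) q.1 h2 h1
  simp only [ContinuousLinearEquiv.apply_symm_apply] at h4
  exact h4.unique hT.2

theorem fderiv_state_top (h : S.IsMongeParametrization r D A B)
    {q : ℝ × ((a : Fin m) → Fin (r a) → ℝ) × (Fin m → ℝ)} (hq : jetEquiv r q ∈ D)
    (w : Fin m → ℝ) : fderiv ℝ (fun q => A (jetEquiv r q)) q (0, 0, w) = 0 := by
  have h1 : ((0, 0, w) : ℝ × ((a : Fin m) → Fin (r a) → ℝ) × (Fin m → ℝ)) =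
      (1, (brunovsky r).f q, w) - (1, (brunovsky r).f q, 0) := by simp
  rw [h1, map_sub, (h.fderiv_state hq w).2, (h.fderiv_state hq 0).2, sub_self]

/-- Were `(t, A)` nowhere a submersion, some open set of jets would have an image without interior;
but that image contains the projection of an open `V`, because a trajectory in `V` passes through
every `(t, x)` occurring in `V`. -/
theorem exists_surjective_fderiv (h : S.IsMongeParametrization r D A B)
    (hpar : ∀ D' ⊆ D, IsOpen D' → D'.Nonempty →
      ∃ V ⊆ S.jets, IsOpen V ∧ V.Nonempty ∧ S.Parametrizes r A B D' V) :
    ∃ q, jetEquiv r q ∈ D ∧ Function.Surjective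
      (fderiv ℝ (fun q => (q.1, A (jetEquiv r q))) q) := by
  by_contra! hns
  obtain ⟨q, hq⟩ := h.nonempty
  obtain ⟨G, hG, hGo, ⟨q₁, hq₁⟩, hint⟩ := exists_interior_image_eq_empty h.isOpen_preimage
    ⟨(jetEquiv r).symm q, by simpa using hq⟩ (contDiffOn_fst.prodMk h.contDiffOn_state) hns
  obtain ⟨V, hVS, hV, ⟨ζ, hζ⟩, hVp⟩ := hpar ((jetEquiv r).symm ⁻¹' G)
    (fun j hj => by simpa using hG hj) (hGo.preimage (jetEquiv r).symm.continuous)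
    ⟨jetEquiv r q₁, by simpa using hq₁⟩
  let pr : TrajectoryJet n m → ℝ × (Fin n → ℝ) := fun ζ => (ζ.1, ζ.2.1)
  have hpr : IsOpenMap pr := IsOpenMap.id.prodMap isOpenMap_fst
  have hsub : pr '' V ⊆ (fun q => (q.1, A (jetEquiv r q))) '' G := by
    rintro _ ⟨ζ, hζ, rfl⟩
    obtain ⟨I, x, u, hT, hIV, htI, hx⟩ := exists_isTrajectory_trajectoryJet_mem S hV hVS hζ
    obtain ⟨J, -, htJ, -, z, -, hz⟩ := hVp I x u hT hIV _ htI
    obtain ⟨hzG, hzx, -⟩ := hz _ htJ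
    refine ⟨_, hzG, Prod.ext rfl ?_⟩
    simp only [ContinuousLinearEquiv.apply_symm_apply, ← hzx, hx, pr]
  have hmem := interior_maximal hsub (hpr V hV) ⟨ζ, hζ, rfl⟩
  rw [hint] at hmem
  exact hmem

end IsMongeParametrization

theorem IsExplicitlyIntegrable.isDynamicFeedbackLinearizable {n m : ℕ}
    {S : ControlSystem (Fin n → ℝ) (Fin m → ℝ)} (hS : S.IsExplicitlyIntegrable) :
    S.IsDynamicFeedbackLinearizable := by
  intro V₀ hV₀ hne hsub
  obtain ⟨r, D, A, B, h, hpar⟩ := hS V₀ hV₀ hne hsub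
  obtain ⟨q₀, hq₀, hsurj⟩ := h.exists_surjective_fderiv fun D' hD' ho hn =>
    (hpar D' hD' ho hn).imp fun V hV => ⟨hV.1.trans hsub, hV.2⟩
  obtain ⟨k, L, A₁, e, hqe, heD, he, hei, hA₁⟩ := exists_chart h.isOpen_preimage
    h.contDiffOn_state (fun q hq => h.fderiv_state_top hq) hq₀ hsurj
  have hesD : ∀ p ∈ e.target, jetEquiv r (e.symm p) ∈ D := fun p hp => heD (e.map_target hp)
  have hp : ∀ p ∈ e.target, p = ((e.symm p).1, (A (jetEquiv r (e.symm p)), L (e.symm p).2.1),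
      (e.symm p).2.2) := fun p hp => by rw [← he, e.right_inv hp]
  -- With `y = L z` and `w` the top-order derivatives, `ẏ` is `L` of the Brunovsky vector field and
  -- `u = B`, both rewritten in the chart `e`.
  let F : DynamicFeedback S k m :=
    { le := le_rfl
      domain := e.target
      isOpen_domain := e.open_target
      g := fun p => L ((brunovsky r).f (e.symm p))
      β := fun p => B (jetEquiv r (e.symm p))
      smooth_g := L.contDiff.comp_contDiffOn
        ((brunovsky r).smooth_f.comp hei fun _ _ => Set.mem_univ _)
      smooth_β := (h.smooth_B.comp (jetEquiv r).contDiff.contDiffOn fun _ hq => hq).comp hei hesD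
      mem_domain := fun p hpt => by
        have h1 := (h.fderiv_state (hesD p hpt) 0).1
        have h2 := hp p hpt
        rw [show p.1 = (e.symm p).1 from congrArg Prod.fst h2,
          show p.2.1.1 = A (jetEquiv r (e.symm p)) from congrArg (fun p => p.2.1.1) h2]
        exact h1 }
  refine ⟨k, m, F, ⟨e q₀, e.map_source hqe⟩, ⟨rfl, ?_⟩, ?_⟩
  · intro N hN hNo hNne
    have hG : IsOpen (e.source ∩ e ⁻¹' N) := e.isOpen_inter_preimage hNo
    -- The jets over `N` serve as `D'`; the functions `z` parametrizing a trajectory then supply `y`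
    -- and `w`.
    obtain ⟨V, hV, hVo, hVne, hVp⟩ := hpar ((jetEquiv r).symm ⁻¹' (e.source ∩ e ⁻¹' N))
      (fun j hj => by simpa using heD hj.1) (hG.preimage (jetEquiv r).symm.continuous) (by
        obtain ⟨p, hpN⟩ := hNne
        refine ⟨jetEquiv r (e.symm p), ?_⟩
        rw [Set.mem_preimage, ContinuousLinearEquiv.symm_apply_apply]
        refine ⟨e.map_target (hN hpN), ?_⟩
        rwa [Set.mem_preimage, e.right_inv (hN hpN)])
    refine ⟨V, hV, hVo, hVne, fun I x u hT hIV t₀ ht₀ => ?_⟩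
    obtain ⟨J, hJ, htJ, hJI, z, hz, hzD⟩ := hVp I x u hT hIV t₀ ht₀
    let q : ℝ → ℝ × ((a : Fin m) → Fin (r a) → ℝ) × (Fin m → ℝ) :=
      fun t => (jetEquiv r).symm (functionJet r z t)
    have hqs : ContDiffOn ℝ ∞ q J := contDiffOn_jetEquiv_symm_functionJet hJ hz
    have hqe : ∀ t ∈ J, (t, (x t, L (q t).2.1), (q t).2.2) = e (q t) := by
      intro t ht
      rw [he, (hzD t ht).2.1]
      simp only [q, ContinuousLinearEquiv.apply_symm_apply]
      rfl
    have hinv : ∀ t ∈ J, e.symm (e (q t)) = q t := fun t ht => e.left_inv (hzD t ht).1.1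
    have hβ : ∀ t ∈ J, u t = F.β (t, (x t, L (q t).2.1), (q t).2.2) := by
      intro t ht
      rw [hqe t ht, (hzD t ht).2.2]
      simp only [F]
      rw [hinv t ht]
      simp only [q, ContinuousLinearEquiv.apply_symm_apply]
    have hmem : ∀ t ∈ J, (t, (x t, L (q t).2.1), (q t).2.2) ∈ N := by
      intro t ht
      rw [hqe t ht]
      exact (hzD t ht).1.2
    refine ⟨J, hJ, htJ, hJI, fun t => L (q t).2.1, fun t => (q t).2.2,
      ⟨hJ, (hT.2.1.mono hJI).prodMk (L.contDiff.comp_contDiffOn hqs.snd.fst), hqs.snd.snd,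
        fun t ht => ⟨hN (hmem t ht), ?_⟩⟩, fun t ht => ⟨hmem t ht, hβ t ht⟩⟩
    refine HasDerivAt.prodMk ?_ ?_
    · have := (hT.2.2.2 t (hJI ht)).2
      rwa [hβ t ht] at this
    · have h1 := L.hasFDerivAt.comp_hasDerivAt t
        ((isTrajectory_brunovsky_functionJet (r := r) hJ hz).2.2.2 t ht).2
      have h2 : F.g (t, (x t, L (q t).2.1), (q t).2.2) = L ((brunovsky r).f (q t)) := by
        rw [hqe t ht]
        simp only [F]
        rw [hinv t ht]
      rw [h2]
      exact h1
  · intro p hpt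
    -- The state map must not involve the control, so `A` is replaced by `A₁`, which agrees with it
    -- on `e.source`.
    let θ : ℝ × ((a : Fin m) → Fin (r a) → ℝ) → (Fin n → ℝ) × (Fin k → ℝ) :=
      fun p => (A₁ p, L p.2)
    have hΦ : Set.EqOn (feedbackMap θ fun q => q.2.2) e e.source := fun q hq => by
      simp only [feedbackMap, θ]
      rw [he, hA₁ q hq]
    let Ψ : PartialDiffeomorph 𝓘(ℝ, ℝ × ((a : Fin m) → Fin (r a) → ℝ) × (Fin m → ℝ))
        𝓘(ℝ, ℝ × ((Fin n → ℝ) × (Fin k → ℝ)) × (Fin m → ℝ))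
        (ℝ × ((a : Fin m) → Fin (r a) → ℝ) × (Fin m → ℝ))
        (ℝ × ((Fin n → ℝ) × (Fin k → ℝ)) × (Fin m → ℝ)) ∞ :=
      { toPartialEquiv := e.toPartialEquiv
        open_source := e.open_source
        open_target := e.open_target
        contMDiffOn_toFun := by
          refine ContDiffOn.contMDiffOn ?_
          refine ContDiffOn.congr (f := fun q => (q.1, (A (jetEquiv r q), L q.2.1), q.2.2)) ?_
            fun q _ => he q
          exact contDiffOn_fst.prodMk (((h.contDiffOn_state.mono heD).prodMk
            (L.contDiff.comp_contDiffOn contDiffOn_snd.fst)).prodMk contDiffOn_snd.snd)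
        contMDiffOn_invFun := hei.contMDiffOn }
    refine ⟨r, h.order_pos, e.source, θ, fun q => q.2.2, ⟨e.open_source, fun _ _ => Set.mem_univ _,
      fun q hq => ?_, fun q => ⟨Ψ, q.2, hΦ⟩, fun q hq => ?_⟩, e.symm p, e.map_target hpt, ?_⟩
    · rw [hΦ hq]
      exact e.map_source hq
    · rw [hΦ hq]
      let ι : ℝ × ((a : Fin m) → Fin (r a) → ℝ) → ℝ × ((a : Fin m) → Fin (r a) → ℝ) × (Fin m → ℝ) :=
        fun p => (p.1, p.2, q.2.2)
      have hι : HasFDerivAt ι ((ContinuousLinearMap.fst ℝ _ _).prod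
          ((ContinuousLinearMap.snd ℝ _ _).prod 0)) (q.1, q.2.1) :=
        hasFDerivAt_fst.prodMk (hasFDerivAt_snd.prodMk (hasFDerivAt_const _ _))
      have h1 : HasFDerivAt A₁ _ (q.1, q.2.1) :=
        (HasFDerivAt.comp (q.1, q.2.1) (f := ι) (h.hasFDerivAt_state (heD hq))
          hι).congr_of_eventuallyEq (by
            filter_upwards [hι.continuousAt.preimage_mem_nhds (e.open_source.mem_nhds hq)]
              with p hp using hA₁ _ hp)
      have h2 : HasFDerivAt θ _ (q.1, q.2.1) := h1.prodMk (L.hasFDerivAt.comp _ hasFDerivAt_snd)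
      rw [h2.fderiv]
      refine Prod.ext ?_ ?_
      -- The control is frozen in `ι`, hence the choice `w = 0`.
      · refine (h.fderiv_state (heD hq) 0).2.trans ?_
        simp only [DynamicFeedback.augmented, F, e.left_inv hq]
        rw [he]
      · simp only [DynamicFeedback.augmented, F, e.left_inv hq]
        rfl
    · rw [hΦ (e.map_target hpt), e.right_inv hpt]

end ControlSystem

theorem mainTheorem5 (n m : ℕ) (S : ControlSystem (Fin n → ℝ) (Fin m → ℝ)) (hS : S.IsRegular) :
    S.IsExplicitlyIntegrable ↔ S.IsDynamicFeedbackLinearizable :=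
  ⟨fun h => h.isDynamicFeedbackLinearizable, fun h => h.isExplicitlyIntegrable⟩
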